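/- Let $U$ be a universal (prefix-free) computer and, for a finite binary string $w$, let $K(w)=K_U(w)$ be its Kolmogorov complexity, the length of the shortest program that makes $U$ print $w$ and halt. For $x\in[0,1]^n$ and $m\ge 0$ let $[x]_m=([x_1]_m,\dots,[x_n]_m)$ be obtained by keeping the first $m$ bits of the binary expansion of each coordinate, and let $K^{[\cdot]_m}(x)=K([x_1]_m,\dots,[x_n]_m)$ be the complexity of the resulting string of $nm$ bits. For each $n$ let $\kappa_n\in\mathbb R$, $m_n=\lceil\log_2 n\rceil$, $d_n=\lceil\kappa_n\log_2 n\rceil$, $\epsilon_n\ge 0$, $x_o^n\in\mathbb R^n$ and $\tilde x_o^n\in[0,1]^n$ be such that $\|x_o^n-\tilde x_o^n\|_2\le\epsilon_n$, and assume that $$\limsup_{n\to\infty}\frac{K^{[\cdot]_{m_n}}(\tilde x_o^n)}{\kappa_n m_n}\le 1,\qquad d_n\to\infty,\qquad \epsilon_n\to 0,\qquad \epsilon_n=o(d_n/n)\qquad(n\to\infty).$$ Let $A\in\mathbb R^{d_n\times n}$ be a random matrix with i.i.d. $N(0,1/d_n)$ entries, let $\sigma_{\max}(A)$ be its largest singular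 value and $y_o^n=Ax_o^n$. Consider the problem $$\min_{x\in[0,1]^n} K^{[\cdot]_{m_n}}(x)\quad\text{subject to}\quad \|Ax-y_o^n\|_2\le\sigma_{\max}(A)\,\epsilon_n .$$ This problem always has a solution, and for every $\epsilon>0$ $$\mathbb P\bigl(\|x_o^n-\hat x_o^n\|_2^2>\epsilon \text{ for some solution } \hat x_o^n\bigr)\to 0\qquad\text{as } n\to\infty$$ (outer probability, if the event is not measurable). In particular, $\mathbb P(\|x_o^n-\hat x_o^n\|_2^2>\epsilon)\to0$ for every choice of a solution $\hat x_o^n=\hat x_o^n(y_o^n,A)$. -/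

import Mathlib

open MeasureTheory ProbabilityTheory Filter Topology Asymptotics

noncomputable section

namespace MCP

/-- A computer: a partial recursive function from binary programs to binary strings (`U p` is
the string printed on input `p`, defined iff the computation halts) whose set of halting programs
is prefix-free. -/
structure IsComputer (U : List Bool →. List Bool) : Prop where
  partrec : Partrec U
  prefixFree : ∀ p q : List Bool, (U p).Dom → (U q).Dom → p <+: q → p = q

/-- A universal computer: a computer that simulates every computer `A`, given a suitable
simulation program `s` (depending on `A` only) in front of the program of `A`. -/
structure IsUniversalComputer (U : List Bool →. List Bool) : Prop where
  isComputer : IsComputer U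
  simulates : ∀ A : List Bool →. List Bool, IsComputer A →
    ∃ s : List Bool, ∀ p x : List Bool, x ∈ A p → x ∈ U (s ++ p)

/-- The Kolmogorov complexity `K_U(x)`: the minimal length of a program that prints `x` and
halts. For a universal computer such a program exists, see `exists_program`. -/
def kolmogorov (U : List Bool →. List Bool) (x : List Bool) : ℕ :=
  sInf {l : ℕ | ∃ p : List Bool, x ∈ U p ∧ p.length = l}

/-- For a universal computer every string is printed by some program, so that the minimum in
`kolmogorov` is over a nonempty set. -/
theorem exists_program {U : List Bool →. List Bool} (hU : IsUniversalComputer U)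
    (x : List Bool) : ∃ p : List Bool, x ∈ U p := by
  let A : List Bool →. List Bool := fun p => ((if p = [] then some x else none : Option _) : Part _)
  have hA : IsComputer A := by
    refine ⟨?_, ?_⟩
    · refine Computable.ofOption (Primrec.to_comp ?_)
      exact Primrec.ite (Primrec.eq.comp Primrec.id (Primrec.const _)) (Primrec.const _)
        (Primrec.const _)
    · intro p q hp hq _
      have h : ∀ r : List Bool, (A r).Dom → r = [] := by
        intro r hr
        by_contra hne
        simp [A, hne] at hr
      rw [h p hp, h q hq]
  obtain ⟨s, hs⟩ := hU.simulates A hA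
  exact ⟨s ++ [], hs [] x (by simp [A])⟩

/-- The `i`-th bit, `i ≥ 1`, of the binary expansion `x = ∑_{i ≥ 1} 2^{-i} (x)_i` of a number
`x ∈ [0,1]`. A dyadic rational `x < 1` has its terminating expansion, and `1 = 0.111…`. -/
def binaryDigit (x : ℝ) (i : ℕ) : Bool :=
  if x = 1 then true else decide (⌊2 ^ i * x⌋₊ % 2 = 1)

/-- The first `m` bits of `x ∈ [0,1]`, i.e. the binary representation of `[x]_m`. -/
def quantBits (m : ℕ) (x : ℝ) : List Bool :=
  (List.range m).map fun i => binaryDigit x (i + 1)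

/-- The cube `[0,1]^n` in `ℝ^n` (with its Euclidean norm). -/
def cube (n : ℕ) : Set (EuclideanSpace ℝ (Fin n)) :=
  {x | ∀ i, x i ∈ Set.Icc (0 : ℝ) 1}

/-- The Kolmogorov complexity at resolution `m`, `K([x_1]_m, …, [x_n]_m)`, of `x ∈ [0,1]^n`:
the complexity of the string of the `n * m` bits of the quantised coordinates, in order. -/
def quantComplexity (U : List Bool →. List Bool) (m : ℕ) {n : ℕ}
    (x : EuclideanSpace ℝ (Fin n)) : ℕ :=
  kolmogorov U (List.ofFn fun i : Fin n => quantBits m (x i)).flatten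

/-- The linear map `x ↦ A x` between Euclidean spaces. -/
def measure {d n : ℕ} (A : Matrix (Fin d) (Fin n) ℝ) :
    EuclideanSpace ℝ (Fin n) →L[ℝ] EuclideanSpace ℝ (Fin d) :=
  LinearMap.toContinuousLinearMap (Matrix.toLpLin 2 2 A)

/-- The largest singular value of `A`, i.e. its `ℓ₂ → ℓ₂` operator norm. -/
def sigmaMax {d n : ℕ} (A : Matrix (Fin d) (Fin n) ℝ) : ℝ := ‖measure A‖

/-- `x` is feasible for the relaxed minimum complexity pursuit with data `y`, matrix `A` and
tolerance `ε`: `x ∈ [0,1]^n` and `‖A x - y‖₂ ≤ σ_max(A) ε`. -/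
def IsFeasible {d n : ℕ} (A : Matrix (Fin d) (Fin n) ℝ) (y : EuclideanSpace ℝ (Fin d)) (ε : ℝ)
    (x : EuclideanSpace ℝ (Fin n)) : Prop :=
  x ∈ cube n ∧ ‖measure A x - y‖ ≤ sigmaMax A * ε

/-- `x` is an output of the relaxed minimum complexity pursuit: it minimises the Kolmogorov
complexity at resolution `m` among all feasible vectors. -/
def IsSolution (U : List Bool →. List Bool) (m : ℕ) {d n : ℕ} (A : Matrix (Fin d) (Fin n) ℝ)
    (y : EuclideanSpace ℝ (Fin d)) (ε : ℝ) (x : EuclideanSpace ℝ (Fin n)) : Prop :=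
  IsFeasible A y ε x ∧
    ∀ z, IsFeasible A y ε z → quantComplexity U m x ≤ quantComplexity U m z

/-- The resolution `m_n = ⌈log₂ n⌉`. -/
def resolution (n : ℕ) : ℕ := ⌈Real.logb 2 n⌉₊

/-- The number of measurements `d_n = ⌈κ_n log₂ n⌉`. -/
def numMeas (κ : ℕ → ℝ) (n : ℕ) : ℕ := ⌈κ n * Real.logb 2 n⌉₊

/-- `A` is a random `d × n` matrix with i.i.d. `N(0, 1/d)` entries. -/
structure IsGaussianMatrix {Ω : Type*} [MeasurableSpace Ω] (P : Measure Ω) {d n : ℕ}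
    (A : Ω → Matrix (Fin d) (Fin n) ℝ) : Prop where
  law : ∀ i j, HasLaw (fun ω => A ω i j) (gaussianReal 0 ((d : NNReal)⁻¹)) P
  indep : iIndepFun (fun (ij : Fin d × Fin n) ω => A ω ij.1 ij.2) P

end MCP

end

namespace MCP

/-! The point `xt` is feasible, so a solution `xhat` is no more complex than `xt`, eventually at
most `4 * d` bits. Its quantisation is thus printed by one of at most `2 ^ (4 * d + 1)` programs.
Each program `p` has a representative `r` in the cube, chosen without reference to `A`; the one for
`xhat` satisfies `‖r - xhat‖ ≤ 1 / √n`.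

A fixed vector `r - xo` is shrunk by more than a factor 100 with probability at most `32 ^ (-d)`
(`gaussianMatrixLaw_sq_norm_lt`), which survives the union bound over programs. Also `σ_max² ≤ 512
(1 + n / d)` outside probability `2 ^ (-d)` (`gaussianMatrixLaw_lt_sq_sigmaMax`). On the good event
`‖r - xo‖ ≤ 100 ‖A (r - xo)‖ ≤ 100 σ_max (1 / √n + ε)`, which tends to 0 because `1 / n`, `1 / d`,
`ε` and `ε n / d` do. -/

/-! ### Exponential moments of `‖A v‖²`. -/

theorem lintegral_exp_mul_sq_gaussianReal {v : NNReal} {c : ℝ} (h : 2 * c * v < 1) :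
    ∫⁻ x, ENNReal.ofReal (Real.exp (c * x ^ 2)) ∂(gaussianReal 0 v)
      = ENNReal.ofReal (√(1 - 2 * c * v))⁻¹ := by
  rcases eq_or_ne v 0 with rfl | hv
  · simp
  have hv' : (0 : ℝ) < v := by positivity
  have hb : 0 < (1 - 2 * c * v) / (2 * v) := div_pos (by linarith) (by linarith)
  rw [gaussianReal_of_var_ne_zero _ hv, lintegral_withDensity_eq_lintegral_mul _
    (measurable_gaussianPDF 0 v) (by fun_prop)]
  have key : ∀ x : ℝ, (gaussianPDF 0 v * fun x => ENNReal.ofReal (Real.exp (c * x ^ 2))) x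
      = ENNReal.ofReal ((√(2 * Real.pi * v))⁻¹ *
        Real.exp (-((1 - 2 * c * v) / (2 * v)) * x ^ 2)) := by
    intro x
    rw [Pi.mul_apply, gaussianPDF, ← ENNReal.ofReal_mul (gaussianPDFReal_nonneg _ _ _),
      gaussianPDFReal, mul_assoc, ← Real.exp_add]
    congr 3
    field_simp
    ring
  simp_rw [key]
  rw [← ofReal_integral_eq_lintegral_ofReal ((integrable_exp_neg_mul_sq hb).const_mul _)
    (ae_of_all _ fun x => by positivity), integral_const_mul, integral_gaussian]
  congr 1
  rw [← Real.sqrt_inv, ← Real.sqrt_mul (by positivity), ← Real.sqrt_inv]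
  congr 1
  have : 1 - 2 * c * v ≠ 0 := by linarith
  have := Real.pi_ne_zero
  field_simp

theorem measure_apply {d n : ℕ} (A : Matrix (Fin d) (Fin n) ℝ) (v : EuclideanSpace ℝ (Fin n))
    (i : Fin d) : measure A v i = ∑ j, A i j * v j := rfl

theorem sq_norm_measure {d n : ℕ} (A : Matrix (Fin d) (Fin n) ℝ)
    (v : EuclideanSpace ℝ (Fin n)) : ‖measure A v‖ ^ 2 = ∑ i, (∑ j, A i j * v j) ^ 2 := by
  rw [EuclideanSpace.norm_sq_eq]
  simp [measure_apply]

/-- A weighted sum of independent centred Gaussians of equal variance is Gaussian. -/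
theorem map_sum_mul_pi_gaussianReal {n : ℕ} (s : NNReal) (v : EuclideanSpace ℝ (Fin n)) :
    (Measure.pi fun _ : Fin n => gaussianReal 0 s).map (fun a => ∑ j, a j * v j)
      = gaussianReal 0 (s * ‖v‖₊ ^ 2) := by
  set μ := Measure.pi fun _ : Fin n => gaussianReal 0 s
  have hmap : ∀ j, μ.map (fun a => a j * v j) = gaussianReal 0 (s * ‖v j‖₊ ^ 2) := by
    intro j
    have h := gaussianReal_mul_const ((measurePreserving_eval
      (fun _ : Fin n => gaussianReal 0 s) j).hasLaw) (v j)
    have h' := h.map_eq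
    simp only [mul_zero] at h'
    refine h'.trans ?_
    congr 1
    ext
    simp [mul_comm]
  refine Measure.ext_of_charFun ?_
  ext t
  have hind : iIndepFun (fun j (a : Fin n → ℝ) => a j * v j) μ :=
    iIndepFun_pi (X := fun j x => x * v j) fun j => by fun_prop
  rw [hind.charFun_map_fun_sum_eq_prod fun j => Measurable.aemeasurable (by fun_prop)]
  simp only [Finset.prod_apply, hmap, charFun_gaussianReal]
  rw [← Complex.exp_sum]
  congr 1
  have hn : ((‖v‖₊ : ℝ)) ^ 2 = ∑ j, ‖v j‖ ^ 2 := EuclideanSpace.norm_sq_eq v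
  have hn' : (((‖v‖₊ : ℝ) : ℂ)) ^ 2 = ∑ j, ((‖v j‖ : ℝ) : ℂ) ^ 2 := by exact_mod_cast hn
  simp only [Complex.ofReal_zero, mul_zero, zero_mul, zero_sub, Finset.sum_neg_distrib]
  push_cast
  rw [← Finset.sum_div, ← Finset.sum_mul, ← Finset.mul_sum]
  simp only [coe_nnnorm] at hn' ⊢
  rw [hn']

/-- The law of a `d × n` matrix with i.i.d. `N(0, 1/d)` entries, row by row. -/
noncomputable def gaussianMatrixLaw (d n : ℕ) : Measure (Fin d → Fin n → ℝ) :=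
  Measure.pi fun _ => Measure.pi fun _ => gaussianReal 0 ((d : NNReal)⁻¹)

instance (d n : ℕ) : IsProbabilityMeasure (gaussianMatrixLaw d n) := by
  unfold gaussianMatrixLaw; infer_instance

/-- The coordinates of `A v` are independent `N(0, ‖v‖² / d)`, one for each row, so the moment
factors. -/
theorem lintegral_exp_mul_sq_norm_measure {d n : ℕ} (v : EuclideanSpace ℝ (Fin n)) {c : ℝ}
    (h : 2 * c * ((d : ℝ)⁻¹ * ‖v‖ ^ 2) < 1) :
    ∫⁻ a, ENNReal.ofReal (Real.exp (c * ‖measure (Matrix.of a) v‖ ^ 2)) ∂(gaussianMatrixLaw d n)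
      = ENNReal.ofReal (√(1 - 2 * c * ((d : ℝ)⁻¹ * ‖v‖ ^ 2)))⁻¹ ^ d := by
  have hexp : ∀ a : Fin d → Fin n → ℝ,
      ENNReal.ofReal (Real.exp (c * ‖measure (Matrix.of a) v‖ ^ 2))
        = ∏ i, ENNReal.ofReal (Real.exp (c * (∑ j, a i j * v j) ^ 2)) := by
    intro a
    rw [sq_norm_measure, Finset.mul_sum, Real.exp_sum,
      ENNReal.ofReal_prod_of_nonneg fun _ _ => (Real.exp_pos _).le]
    rfl
  simp_rw [hexp]
  rw [gaussianMatrixLaw, lintegral_prod_eq_prod_lintegral_of_indepFun Finset.univ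
    (fun i (a : Fin d → Fin n → ℝ) => ENNReal.ofReal (Real.exp (c * (∑ j, a i j * v j) ^ 2)))
    (iIndepFun_pi (X := fun _ (r : Fin n → ℝ) =>
      ENNReal.ofReal (Real.exp (c * (∑ j, r j * v j) ^ 2))) fun _ => Measurable.aemeasurable (by fun_prop))
    (fun _ => by fun_prop)]
  have hrow : ∀ i : Fin d, ∫⁻ a : Fin d → Fin n → ℝ,
      ENNReal.ofReal (Real.exp (c * (∑ j, a i j * v j) ^ 2))
        ∂(Measure.pi fun _ => Measure.pi fun _ => gaussianReal 0 ((d : NNReal)⁻¹))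
      = ENNReal.ofReal (√(1 - 2 * c * ((d : ℝ)⁻¹ * ‖v‖ ^ 2)))⁻¹ := by
    intro i
    have h1 := (measurePreserving_eval (fun _ : Fin d =>
      Measure.pi fun _ : Fin n => gaussianReal 0 ((d : NNReal)⁻¹)) i).lintegral_comp
      (f := fun r => ENNReal.ofReal (Real.exp (c * (∑ j, r j * v j) ^ 2))) (by fun_prop)
    refine h1.trans ?_
    have h2 := lintegral_map (μ := Measure.pi fun _ : Fin n => gaussianReal 0 ((d : NNReal)⁻¹))
      (f := fun x : ℝ => ENNReal.ofReal (Real.exp (c * x ^ 2)))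
      (g := fun a : Fin n → ℝ => ∑ j, a j * v j) (by fun_prop) (by fun_prop)
    rw [← h2, map_sum_mul_pi_gaussianReal, lintegral_exp_mul_sq_gaussianReal]
    · simp
    · simpa using h
  rw [Finset.prod_congr rfl fun i _ => hrow i]
  simp

theorem IsGaussianMatrix.hasLaw {Ω : Type*} [MeasurableSpace Ω] {P : Measure Ω}
    [IsProbabilityMeasure P] {d n : ℕ} {A : Ω → Matrix (Fin d) (Fin n) ℝ}
    (hA : IsGaussianMatrix P A) :
    HasLaw (fun ω i j => A ω i j) (gaussianMatrixLaw d n) P := by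
  have h1 := hA.indep.hasLaw_pi (fun ij : Fin d × Fin n => hA.law ij.1 ij.2)
  have h2 : HasLaw (MeasurableEquiv.curry (Fin d) (Fin n) ℝ) (gaussianMatrixLaw d n)
      (Measure.pi fun _ : Fin d × Fin n => gaussianReal 0 ((d : NNReal)⁻¹)) := by
    refine ⟨by fun_prop, ?_⟩
    have h3 := Measure.infinitePi_map_curry
      (fun (_ : Fin d) (_ : Fin n) => gaussianReal 0 ((d : NNReal)⁻¹))
    simpa only [Measure.infinitePi_eq_pi, gaussianMatrixLaw] using h3
  exact h2.comp h1

theorem measurable_sq_norm_measure (d n : ℕ) :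
    Measurable fun p : (Fin d → Fin n → ℝ) × EuclideanSpace ℝ (Fin n) =>
      ‖measure (Matrix.of p.1) p.2‖ ^ 2 := by
  simp_rw [sq_norm_measure, Matrix.of_apply]
  fun_prop

/-! ### Tail bounds for Gaussian matrices. -/

/-- A Gaussian matrix is unlikely to shrink a given vector by a large factor. -/
theorem gaussianMatrixLaw_sq_norm_lt {d n : ℕ} (v : EuclideanSpace ℝ (Fin n)) :
    gaussianMatrixLaw d n {a | ‖measure (Matrix.of a) v‖ ^ 2 < ‖v‖ ^ 2 / 10000}
      ≤ ENNReal.ofReal ((1 / 32) ^ d) := by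
  rcases eq_or_ne v 0 with rfl | hv
  · simp
  rcases Nat.eq_zero_or_pos d with rfl | hd
  · simpa using prob_le_one
  have hd' : (0 : ℝ) < d := by exact_mod_cast hd
  have hv' : 0 < ‖v‖ := norm_pos_iff.2 hv
  -- Chernoff bound: on the event `exp (c ‖A v‖²) ≥ exp (-d)`, while the expectation is `20001 ^ (-d
  -- / 2)`.
  set c : ℝ := -(10000 * d / ‖v‖ ^ 2) with hc
  have hcv : 2 * c * ((d : ℝ)⁻¹ * ‖v‖ ^ 2) = -20000 := by
    rw [hc]; field_simp; norm_num
  have hlaw := lintegral_exp_mul_sq_norm_measure (d := d) v (c := c) (by rw [hcv]; norm_num)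
  rw [hcv] at hlaw
  have hmeas : Measurable fun a : Fin d → Fin n → ℝ =>
      ENNReal.ofReal (Real.exp (c * ‖measure (Matrix.of a) v‖ ^ 2)) := by
    have := (measurable_sq_norm_measure d n).comp (measurable_id.prodMk (measurable_const (a := v)))
    exact ((this.const_mul c).exp).ennreal_ofReal
  have hmarkov := mul_meas_ge_le_lintegral hmeas (μ := gaussianMatrixLaw d n)
    (ENNReal.ofReal (Real.exp (-d)))
  rw [hlaw] at hmarkov
  have hsub : {a : Fin d → Fin n → ℝ | ‖measure (Matrix.of a) v‖ ^ 2 < ‖v‖ ^ 2 / 10000} ⊆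
      {a | ENNReal.ofReal (Real.exp (-d))
        ≤ ENNReal.ofReal (Real.exp (c * ‖measure (Matrix.of a) v‖ ^ 2))} := by
    intro a ha
    refine ENNReal.ofReal_le_ofReal (Real.exp_le_exp.2 ?_)
    have h1 : 10000 * d / ‖v‖ ^ 2 * ‖measure (Matrix.of a) v‖ ^ 2
        ≤ 10000 * d / ‖v‖ ^ 2 * (‖v‖ ^ 2 / 10000) :=
      mul_le_mul_of_nonneg_left (le_of_lt ha) (by positivity)
    have h2 : 10000 * d / ‖v‖ ^ 2 * (‖v‖ ^ 2 / 10000) = d := by field_simp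
    rw [hc]
    linarith
  have h3 := (mul_le_mul_right (measure_mono hsub) _).trans hmarkov
  have hroot : (√(1 - -20000))⁻¹ ≤ Real.exp (-1) * (1 / 32) := by
    have he : Real.exp 1 ≤ 4 := by linarith [Real.exp_one_lt_d9]
    have hs : 128 ≤ √(1 - -20000) := Real.le_sqrt_of_sq_le (by norm_num)
    have h5 : 4⁻¹ ≤ Real.exp (-1) := by
      rw [Real.exp_neg]; exact inv_anti₀ (Real.exp_pos _) he
    have h6 : (√(1 - -20000))⁻¹ ≤ 128⁻¹ := inv_anti₀ (by norm_num) hs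
    linarith
  have h4 : ENNReal.ofReal (√(1 - -20000))⁻¹ ^ d
      ≤ ENNReal.ofReal (Real.exp (-d)) * ENNReal.ofReal ((1 / 32) ^ d) := by
    rw [← ENNReal.ofReal_pow (by positivity), ← ENNReal.ofReal_mul (Real.exp_pos _).le]
    refine ENNReal.ofReal_le_ofReal ?_
    have h7 : Real.exp (-d) = Real.exp (-1) ^ d := by rw [← Real.exp_nat_mul]; simp
    rw [h7, ← mul_pow]
    exact pow_le_pow_left₀ (by positivity) hroot d
  exact (ENNReal.mul_le_mul_iff_right (by simp [Real.exp_pos]) ENNReal.ofReal_ne_top).1 (h3.trans h4)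

/-- Averaging `exp (d ‖A v‖² / 16)` over a ball of radius `2` bounds the operator norm of `A`
from above, since `‖A v‖ ≥ ‖A‖ / 4` on some ball of radius `1 / 2`. -/
theorem exp_mul_sq_sigmaMax_le {d n : ℕ} (A : Matrix (Fin d) (Fin n) ℝ) :
    ENNReal.ofReal (Real.exp (d * sigmaMax A ^ 2 / 256)) *
        volume (Metric.ball (0 : EuclideanSpace ℝ (Fin n)) (1 / 2))
      ≤ ∫⁻ v in Metric.ball (0 : EuclideanSpace ℝ (Fin n)) 2,
          ENNReal.ofReal (Real.exp (d / 16 * ‖measure A v‖ ^ 2)) := by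
  obtain ⟨w, hw, hAw⟩ : ∃ w : EuclideanSpace ℝ (Fin n), ‖w‖ < 1 ∧
      3 / 4 * sigmaMax A ≤ ‖measure A w‖ := by
    rcases (norm_nonneg (measure A)).eq_or_lt with h0 | hpos
    · exact ⟨0, by simp, by simp [sigmaMax, ← h0]⟩
    · obtain ⟨w, hw, h⟩ := (measure A).exists_lt_apply_of_lt_opNorm
        (show 3 / 4 * ‖measure A‖ < ‖measure A‖ by linarith)
      exact ⟨w, hw, h.le⟩
  have hsub : Metric.ball w (1 / 2) ⊆ Metric.ball (0 : EuclideanSpace ℝ (Fin n)) 2 :=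
    Metric.ball_subset_ball' (by rw [dist_zero_right]; linarith)
  calc _ = ∫⁻ _ in Metric.ball w (1 / 2),
          ENNReal.ofReal (Real.exp (d * sigmaMax A ^ 2 / 256)) := by
        rw [setLIntegral_const, Measure.addHaar_ball_center volume w]
    _ ≤ ∫⁻ v in Metric.ball w (1 / 2),
          ENNReal.ofReal (Real.exp (d / 16 * ‖measure A v‖ ^ 2)) := by
        refine setLIntegral_mono' measurableSet_ball fun v hv => ?_
        refine ENNReal.ofReal_le_ofReal (Real.exp_le_exp.2 ?_)
        rw [Metric.mem_ball, dist_eq_norm] at hv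
        have h0 : 0 ≤ sigmaMax A := norm_nonneg _
        have h1 : ‖measure A (v - w)‖ ≤ sigmaMax A * (1 / 2) :=
          ((measure A).le_opNorm _).trans (mul_le_mul_of_nonneg_left hv.le h0)
        have h2 : ‖measure A w‖ ≤ ‖measure A v‖ + ‖measure A (v - w)‖ := by
          rw [map_sub]
          exact norm_le_norm_add_norm_sub _ _
        -- The factor is `3 / 4 - 1 / 2`.
        have h3 : sigmaMax A / 4 ≤ ‖measure A v‖ := by linarith
        have h4 : (sigmaMax A / 4) ^ 2 ≤ ‖measure A v‖ ^ 2 := pow_le_pow_left₀ (by positivity) h3 2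
        have h5 : (d : ℝ) / 16 * (sigmaMax A / 4) ^ 2 ≤ d / 16 * ‖measure A v‖ ^ 2 :=
          mul_le_mul_of_nonneg_left h4 (by positivity)
        linarith
    _ ≤ _ := lintegral_mono_set hsub

/-- The largest singular value of a Gaussian matrix is `O(1 + √(n / d))` with high probability. -/
theorem gaussianMatrixLaw_lt_sq_sigmaMax {d n : ℕ} (hd : 0 < d) :
    gaussianMatrixLaw d n {a | 512 * (1 + n / d) < sigmaMax (Matrix.of a) ^ 2}
      ≤ ENNReal.ofReal ((1 / 2) ^ d) := by
  have hd' : (0 : ℝ) < d := by exact_mod_cast hd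
  set B : Set (EuclideanSpace ℝ (Fin n)) := Metric.ball 0 2
  set V : ENNReal := volume (Metric.ball (0 : EuclideanSpace ℝ (Fin n)) (1 / 2))
  have hB : volume B = ENNReal.ofReal (4 ^ n) * V := by
    have := Measure.addHaar_ball_mul_of_pos (volume : Measure (EuclideanSpace ℝ (Fin n))) 0
      (show (0 : ℝ) < 4 by norm_num) (1 / 2)
    rw [finrank_euclideanSpace_fin] at this
    rw [← this]
    norm_num [B]
  have hV0 : V ≠ 0 := (Metric.measure_ball_pos volume 0 (by norm_num)).ne'
  have hVt : V ≠ ⊤ := measure_ball_lt_top.ne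
  have hmeas : Measurable fun p : (Fin d → Fin n → ℝ) × EuclideanSpace ℝ (Fin n) =>
      ENNReal.ofReal (Real.exp (d / 16 * ‖measure (Matrix.of p.1) p.2‖ ^ 2)) :=
    (((measurable_sq_norm_measure d n).const_mul _).exp).ennreal_ofReal
  have hint : ∫⁻ a, (∫⁻ v in B,
      ENNReal.ofReal (Real.exp (d / 16 * ‖measure (Matrix.of a) v‖ ^ 2))) ∂(gaussianMatrixLaw d n)
      ≤ ENNReal.ofReal (2 ^ d * 4 ^ n) * V := by
    -- By Tonelli only the moment at a fixed `v` is needed; for `‖v‖ < 2` each row contributes a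
    -- factor at most `√2 ≤ 2`.
    rw [lintegral_lintegral_swap hmeas.aemeasurable]
    calc _ ≤ ∫⁻ _ in B, ENNReal.ofReal (2 ^ d) := by
          refine setLIntegral_mono' measurableSet_ball fun v hv => ?_
          have hv2 : ‖v‖ ^ 2 ≤ 4 := by
            have : ‖v‖ < 2 := by simpa [B] using hv
            nlinarith [norm_nonneg v]
          have hcv : 2 * ((d : ℝ) / 16) * ((d : ℝ)⁻¹ * ‖v‖ ^ 2) = ‖v‖ ^ 2 / 8 := by
            field_simp; ring
          rw [lintegral_exp_mul_sq_norm_measure v (by rw [hcv]; linarith), hcv,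
            ← ENNReal.ofReal_pow (by positivity)]
          refine ENNReal.ofReal_le_ofReal (pow_le_pow_left₀ (by positivity) ?_ d)
          have h1 : 2⁻¹ ≤ √(1 - ‖v‖ ^ 2 / 8) := Real.le_sqrt_of_sq_le (by norm_num; linarith)
          simpa using inv_anti₀ (by norm_num) h1
      _ = _ := by
          rw [setLIntegral_const, hB, ← mul_assoc, ← ENNReal.ofReal_mul (by positivity)]
  -- On the event `d σ_max² / 256 > 2 (d + n)`. As `exp 2 ≥ 4`, this threshold absorbs the volume
  -- ratio `4 ^ n` and turns `2 ^ d` into `2 ^ (-d)`.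
  have hmarkov := mul_meas_ge_le_lintegral (μ := gaussianMatrixLaw d n)
    (hmeas.lintegral_prod_right' (ν := volume.restrict B))
    (ENNReal.ofReal (Real.exp (2 * (d + n))) * V)
  have hsub : {a : Fin d → Fin n → ℝ | 512 * (1 + n / d) < sigmaMax (Matrix.of a) ^ 2} ⊆
      {a | ENNReal.ofReal (Real.exp (2 * (d + n))) * V ≤ ∫⁻ v in B,
        ENNReal.ofReal (Real.exp (d / 16 * ‖measure (Matrix.of a) v‖ ^ 2))} := by
    intro a ha
    refine le_trans ?_ (exp_mul_sq_sigmaMax_le (Matrix.of a))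
    refine mul_le_mul_left (ENNReal.ofReal_le_ofReal (Real.exp_le_exp.2 ?_)) _
    have h1 : (d : ℝ) * (512 * (1 + n / d)) ≤ d * sigmaMax (Matrix.of a) ^ 2 :=
      mul_le_mul_of_nonneg_left (le_of_lt ha) hd'.le
    have h2 : (d : ℝ) * (512 * (1 + n / d)) = 512 * (d + n) := by field_simp
    linarith
  have h3 := ((mul_le_mul_right (measure_mono hsub) _).trans hmarkov).trans hint
  have h4 : ENNReal.ofReal (2 ^ d * 4 ^ n)
      ≤ ENNReal.ofReal (Real.exp (2 * (d + n))) * ENNReal.ofReal ((1 / 2) ^ d) := by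
    rw [← ENNReal.ofReal_mul (Real.exp_pos _).le]
    refine ENNReal.ofReal_le_ofReal ?_
    have he : 4 ≤ Real.exp 2 := by
      have h1 : Real.exp 2 = Real.exp 1 * Real.exp 1 := by rw [← Real.exp_add]; norm_num
      nlinarith [Real.exp_one_gt_d9]
    have h5 : Real.exp (2 * (d + n)) = Real.exp 2 ^ d * Real.exp 2 ^ n := by
      rw [← pow_add, ← Real.exp_nat_mul]; push_cast; ring_nf
    have h6 : (2 : ℝ) ^ d = 4 ^ d * (1 / 2) ^ d := by rw [← mul_pow]; norm_num
    rw [h5, h6]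
    calc (4 : ℝ) ^ d * (1 / 2) ^ d * 4 ^ n = 4 ^ d * 4 ^ n * (1 / 2) ^ d := by ring
      _ ≤ _ := by gcongr
  have h5 : V * (ENNReal.ofReal (Real.exp (2 * (d + n))) *
        gaussianMatrixLaw d n {a | 512 * (1 + n / d) < sigmaMax (Matrix.of a) ^ 2})
      ≤ V * (ENNReal.ofReal (Real.exp (2 * (d + n))) * ENNReal.ofReal ((1 / 2) ^ d)) := by
    calc _ = ENNReal.ofReal (Real.exp (2 * (d + n))) * V *
        gaussianMatrixLaw d n {a | 512 * (1 + n / d) < sigmaMax (Matrix.of a) ^ 2} := by ring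
      _ ≤ ENNReal.ofReal (2 ^ d * 4 ^ n) * V := h3
      _ ≤ _ := by rw [mul_comm V]; exact mul_le_mul_left h4 _
  exact (ENNReal.mul_le_mul_iff_right (by simp [Real.exp_pos]) ENNReal.ofReal_ne_top).1
    ((ENNReal.mul_le_mul_iff_right hV0 hVt).1 h5)

/-! ### Binary digits and quantisation error. -/

/-- The integer `⌊2 ^ m x⌋` whose binary expansion consists of the first `m` digits of `x`. -/
noncomputable def dyadicFloor (m : ℕ) (x : ℝ) : ℕ :=
  if x = 1 then 2 ^ m - 1 else ⌊2 ^ m * x⌋₊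

theorem dyadicFloor_succ (m : ℕ) (x : ℝ) :
    dyadicFloor (m + 1) x = 2 * dyadicFloor m x + (binaryDigit x (m + 1)).toNat := by
  unfold dyadicFloor binaryDigit
  split_ifs with h
  · have := Nat.one_le_two_pow (n := m)
    rw [pow_succ, Bool.toNat_true]
    omega
  · have h1 : ⌊2 ^ m * x⌋₊ = ⌊2 ^ (m + 1) * x⌋₊ / 2 := by
      rw [← Nat.floor_div_natCast]
      congr 1
      push_cast
      ring
    rw [h1]
    by_cases h2 : ⌊2 ^ (m + 1) * x⌋₊ % 2 = 1 <;> simp [h2] <;> omega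

theorem dyadicFloor_eq_of_quantBits_eq {m : ℕ} {x y : ℝ} (h : quantBits m x = quantBits m y)
    (hx : x ∈ Set.Icc (0 : ℝ) 1) (hy : y ∈ Set.Icc (0 : ℝ) 1) :
    dyadicFloor m x = dyadicFloor m y := by
  have hd : ∀ i < m, binaryDigit x (i + 1) = binaryDigit y (i + 1) := by
    intro i hi
    exact List.map_inj_left.1 h i (List.mem_range.2 hi)
  clear h
  induction m with
  | zero =>
    have h0 : ∀ z ∈ Set.Icc (0 : ℝ) 1, dyadicFloor 0 z = 0 := by
      intro z hz
      unfold dyadicFloor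
      split_ifs with h1
      · rfl
      · simpa using lt_of_le_of_ne hz.2 h1
    rw [h0 x hx, h0 y hy]
  | succ m ih =>
    rw [dyadicFloor_succ, dyadicFloor_succ, ih fun i hi => hd i (by omega), hd m (by omega)]

/-- The upper bound is not strict: `x = 1 = 0.111…` attains it. -/
theorem dyadicFloor_le {m : ℕ} {x : ℝ} (hx : x ∈ Set.Icc (0 : ℝ) 1) :
    (dyadicFloor m x : ℝ) ≤ 2 ^ m * x ∧ 2 ^ m * x ≤ dyadicFloor m x + 1 := by
  unfold dyadicFloor
  split_ifs with h
  · rw [Nat.cast_sub Nat.one_le_two_pow]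
    subst h
    push_cast
    constructor <;> linarith
  · exact ⟨Nat.floor_le (mul_nonneg (by positivity) hx.1), (Nat.lt_floor_add_one _).le⟩

theorem abs_sub_le_of_quantBits_eq {m : ℕ} {x y : ℝ} (h : quantBits m x = quantBits m y)
    (hx : x ∈ Set.Icc (0 : ℝ) 1) (hy : y ∈ Set.Icc (0 : ℝ) 1) : 2 ^ m * |x - y| ≤ 1 := by
  have h1 := dyadicFloor_le (m := m) hx
  have h2 := dyadicFloor_le (m := m) hy
  rw [dyadicFloor_eq_of_quantBits_eq h hx hy] at h1
  have h3 : (2 : ℝ) ^ m * |x - y| = |2 ^ m * x - 2 ^ m * y| := by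
    rw [← mul_sub, abs_mul, abs_of_pos (by positivity : (0 : ℝ) < 2 ^ m)]
  rw [h3, abs_le]
  constructor <;> linarith [h1.1, h1.2, h2.1, h2.2]

/-- The string of the first `m` bits of all coordinates, in order. -/
noncomputable def quantString (m : ℕ) {n : ℕ} (x : EuclideanSpace ℝ (Fin n)) : List Bool :=
  (List.ofFn fun i : Fin n => quantBits m (x i)).flatten

/-- All blocks have length `m`, so flattening loses nothing. -/
theorem quantBits_eq_of_quantString_eq {m n : ℕ} {x y : EuclideanSpace ℝ (Fin n)}
    (h : quantString m x = quantString m y) (i : Fin n) :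
    quantBits m (x i) = quantBits m (y i) := by
  have hL := List.eq_iff_flatten_eq.2 ⟨h, by
    simp [List.map_ofFn, Function.comp_def, quantBits]⟩
  exact congrFun (List.ofFn_injective hL) i

/-- Each of the `n` coordinates moves by at most `2 ^ (-m) ≤ 1 / n`. -/
theorem sq_norm_sub_le_of_quantString_eq {m n : ℕ} (hm : (n : ℝ) ≤ 2 ^ m)
    {x y : EuclideanSpace ℝ (Fin n)} (hx : x ∈ cube n) (hy : y ∈ cube n)
    (h : quantString m x = quantString m y) : ‖x - y‖ ^ 2 ≤ 1 / n := by
  rcases Nat.eq_zero_or_pos n with rfl | hn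
  · simp [Subsingleton.elim x y]
  have hn' : (0 : ℝ) < n := by exact_mod_cast hn
  rw [EuclideanSpace.norm_sq_eq]
  have h1 : ∀ i ∈ Finset.univ, ‖(x - y) i‖ ^ 2 ≤ (1 / (n : ℝ)) ^ 2 := by
    intro i _
    refine pow_le_pow_left₀ (norm_nonneg _) ?_ 2
    have h2 := abs_sub_le_of_quantBits_eq (quantBits_eq_of_quantString_eq h i) (hx i) (hy i)
    rw [le_div_iff₀ hn', PiLp.sub_apply, Real.norm_eq_abs]
    nlinarith [abs_nonneg (x i - y i)]
  refine (Finset.sum_le_sum h1).trans (le_of_eq ?_)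
  simp
  field_simp

theorem le_two_pow_resolution (n : ℕ) : (n : ℝ) ≤ 2 ^ resolution n := by
  rcases Nat.eq_zero_or_pos n with rfl | hn
  · simp
  have hn' : (0 : ℝ) < n := by exact_mod_cast hn
  rw [← Real.rpow_natCast, ← Real.logb_le_iff_le_rpow (by norm_num) hn']
  exact Nat.le_ceil _

theorem resolution_le {n : ℕ} (hn : 2 ≤ n) : (resolution n : ℝ) ≤ 2 * Real.logb 2 n := by
  have h1 : 1 ≤ Real.logb 2 n := by
    rw [Real.le_logb_iff_rpow_le (by norm_num) (by positivity)]
    simpa using (by exact_mod_cast hn : (2 : ℝ) ≤ n)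
  have := Nat.ceil_lt_add_one (zero_le_one.trans h1)
  unfold resolution
  linarith

/-! ### Counting programs, feasibility and existence of solutions. -/

theorem exists_program_length_eq {U : List Bool →. List Bool} (hU : IsUniversalComputer U)
    (w : List Bool) : ∃ p : List Bool, w ∈ U p ∧ p.length = kolmogorov U w := by
  obtain ⟨p, hp⟩ := exists_program hU w
  exact Nat.sInf_mem (s := {l : ℕ | ∃ p : List Bool, w ∈ U p ∧ p.length = l}) ⟨_, p, hp, rfl⟩

/-- The binary strings of length at most `L`. -/
def programs (L : ℕ) : Finset (List Bool) :=
  (Finset.range (L + 1)).biUnion fun l =>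
    Finset.univ.image (List.ofFn : (Fin l → Bool) → List Bool)

theorem mem_programs {L : ℕ} {p : List Bool} (h : p.length ≤ L) : p ∈ programs L := by
  simp only [programs, Finset.mem_biUnion, Finset.mem_range, Finset.mem_image, Finset.mem_univ,
    true_and]
  exact ⟨p.length, by omega, p.get, List.ofFn_get p⟩

theorem card_programs_le (L : ℕ) : (programs L).card ≤ 2 ^ (L + 1) := by
  calc (programs L).card ≤ ∑ l ∈ Finset.range (L + 1), 2 ^ l := by
        refine Finset.card_biUnion_le.trans (Finset.sum_le_sum fun l _ => ?_)
        exact Finset.card_image_le.trans (by simp)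
    _ ≤ 2 ^ (L + 1) := (Nat.geomSum_lt le_rfl (by simp)).le

open Classical in
/-- A point of the cube whose quantisation is printed by `p`, if there is one. -/
noncomputable def representative (U : List Bool →. List Bool) (m n : ℕ) (p : List Bool) :
    EuclideanSpace ℝ (Fin n) :=
  if h : ∃ x ∈ cube n, quantString m x ∈ U p then h.choose else 0

theorem representative_spec {U : List Bool →. List Bool} {m n : ℕ} {p : List Bool}
    {x : EuclideanSpace ℝ (Fin n)} (hx : x ∈ cube n) (hp : quantString m x ∈ U p) :
    representative U m n p ∈ cube n ∧
      quantString m (representative U m n p) = quantString m x := by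
  have h : ∃ x ∈ cube n, quantString m x ∈ U p := ⟨x, hx, hp⟩
  rw [representative, dif_pos h]
  exact ⟨h.choose_spec.1, Part.mem_unique h.choose_spec.2 hp⟩

theorem isFeasible_of_norm_sub_le {d n : ℕ} (A : Matrix (Fin d) (Fin n) ℝ)
    {xo xt : EuclideanSpace ℝ (Fin n)} {ε : ℝ} (hxt : xt ∈ cube n) (h : ‖xo - xt‖ ≤ ε) :
    IsFeasible A (measure A xo) ε xt := by
  refine ⟨hxt, ?_⟩
  rw [← map_sub, ← norm_neg, ← map_neg, neg_sub]
  exact ((measure A).le_opNorm _).trans (mul_le_mul_of_nonneg_left h (norm_nonneg _))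

/-- The objective takes values in `ℕ`, so its minimum is attained without any compactness. -/
theorem exists_isSolution (U : List Bool →. List Bool) (m : ℕ) {d n : ℕ}
    {A : Matrix (Fin d) (Fin n) ℝ} {y : EuclideanSpace ℝ (Fin d)} {ε : ℝ}
    {x : EuclideanSpace ℝ (Fin n)} (hx : IsFeasible A y ε x) :
    ∃ xhat, IsSolution U m A y ε xhat := by
  have hne : {z | IsFeasible A y ε z}.Nonempty := ⟨x, hx⟩
  refine ⟨Function.argminOn (quantComplexity U m) _ hne, Function.argminOn_mem _ _ hne, ?_⟩
  intro z hz
  exact Function.argminOn_le (quantComplexity U m) _ hz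

/-! ### Deterministic error bound. -/

/-- The recovery error on the event that `A` has a moderate norm and does not shrink the vectors
`representative U m n p - xo`. -/
noncomputable def errorBound (d n : ℕ) (ε : ℝ) : ℝ :=
  100 * (√(512 * (ε ^ 2 + ε * n / d * ε)) + √(512 * (1 / n + 1 / d))) + √(1 / n)

theorem norm_sub_le_errorBound {U : List Bool →. List Bool} (hU : IsUniversalComputer U)
    {d n m L : ℕ} (hn : 0 < n) (hm : (n : ℝ) ≤ 2 ^ m) {A : Matrix (Fin d) (Fin n) ℝ}
    {xo xt xhat : EuclideanSpace ℝ (Fin n)} {ε : ℝ} (hxt : xt ∈ cube n) (hε : ‖xo - xt‖ ≤ ε)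
    (hL : quantComplexity U m xt ≤ L) (hσ : sigmaMax A ^ 2 ≤ 512 * (1 + n / d))
    (hA : ∀ p ∈ programs L, ‖representative U m n p - xo‖ ^ 2 / 10000
      ≤ ‖measure A (representative U m n p - xo)‖ ^ 2)
    (hsol : IsSolution U m A (measure A xo) ε xhat) :
    ‖xo - xhat‖ ≤ errorBound d n ε := by
  have hn' : (0 : ℝ) < n := by exact_mod_cast hn
  have hε0 : 0 ≤ ε := (norm_nonneg _).trans hε
  have hσ0 : 0 ≤ sigmaMax A := norm_nonneg _
  obtain ⟨⟨hcube, hfeas⟩, hmin⟩ := hsol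
  obtain ⟨p, hp, hlen⟩ := exists_program_length_eq hU (quantString m xhat)
  have hpL : p ∈ programs L :=
    mem_programs (hlen.le.trans ((hmin xt (isFeasible_of_norm_sub_le A hxt hε)).trans hL))
  obtain ⟨hrc, hrq⟩ := representative_spec hcube hp
  specialize hA p hpL
  set r := representative U m n p
  have he2 : ‖r - xhat‖ ^ 2 ≤ 1 / n := sq_norm_sub_le_of_quantString_eq hm hrc hcube hrq
  have he : ‖r - xhat‖ ≤ √(1 / n) := Real.le_sqrt_of_sq_le he2
  have hσε : sigmaMax A * ε ≤ √(512 * (ε ^ 2 + ε * n / d * ε)) := by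
    refine Real.le_sqrt_of_sq_le ?_
    calc (sigmaMax A * ε) ^ 2 = sigmaMax A ^ 2 * ε ^ 2 := by ring
      _ ≤ 512 * (1 + n / d) * ε ^ 2 := by gcongr
      _ = _ := by ring
  have hσe : sigmaMax A * ‖r - xhat‖ ≤ √(512 * (1 / n + 1 / d)) := by
    refine Real.le_sqrt_of_sq_le ?_
    calc (sigmaMax A * ‖r - xhat‖) ^ 2 = sigmaMax A ^ 2 * ‖r - xhat‖ ^ 2 := by ring
      _ ≤ 512 * (1 + (n : ℝ) / d) * (1 / n) := by gcongr
      _ = _ := by field_simp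
  have h1 : ‖measure A (r - xo)‖ ≤ sigmaMax A * ‖r - xhat‖ + sigmaMax A * ε := by
    have h2 : measure A (r - xo) = measure A (r - xhat) + (measure A xhat - measure A xo) := by
      simp only [map_sub]; abel
    rw [h2]
    exact (norm_add_le _ _).trans (add_le_add ((measure A).le_opNorm _) hfeas)
  have h3 : ‖r - xo‖ ≤ 100 * ‖measure A (r - xo)‖ := by
    refine (sq_le_sq₀ (norm_nonneg _) (by positivity)).1 ?_
    rw [mul_pow]
    linarith
  have h4 : ‖xo - xhat‖ ≤ ‖r - xo‖ + ‖r - xhat‖ := by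
    have h5 : xo - xhat = (r - xhat) - (r - xo) := by abel
    rw [h5, add_comm]
    exact norm_sub_le _ _
  unfold errorBound
  linarith

/-- The ratio `n / d` may be unbounded; it enters only through `ε n / d`, which `hεd` sends to 0. -/
theorem tendsto_errorBound {d : ℕ → ℕ} {ε : ℕ → ℝ} (hd : Tendsto d atTop atTop)
    (hε : Tendsto ε atTop (𝓝 0)) (hεd : ε =o[atTop] fun n => (d n : ℝ) / (n : ℝ)) :
    Tendsto (fun n => errorBound (d n) n (ε n)) atTop (𝓝 0) := by
  have h1 : Tendsto (fun n => ε n * n / d n) atTop (𝓝 0) := by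
    refine hεd.tendsto_div_nhds_zero.congr fun n => ?_
    rw [div_div_eq_mul_div]
  have hn : Tendsto (fun n : ℕ => 1 / (n : ℝ)) atTop (𝓝 0) := tendsto_one_div_atTop_nhds_zero_nat
  have hdn : Tendsto (fun n => 1 / (d n : ℝ)) atTop (𝓝 0) := hn.comp hd
  have h2 := ((((hε.pow 2).add (h1.mul hε)).const_mul 512).sqrt.add
    ((hn.add hdn).const_mul 512).sqrt).const_mul 100 |>.add hn.sqrt
  simpa [errorBound] using h2

/-! ### Union bound and conclusion. -/

theorem gaussianMatrixLaw_exists_isSolution_le {U : List Bool →. List Bool}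
    (hU : IsUniversalComputer U) {d n m : ℕ} (hd : 0 < d) (hn : 0 < n) (hm : (n : ℝ) ≤ 2 ^ m)
    {xo xt : EuclideanSpace ℝ (Fin n)} {ε η : ℝ} (hxt : xt ∈ cube n) (hε : ‖xo - xt‖ ≤ ε)
    (hL : quantComplexity U m xt ≤ 4 * d) (hη : errorBound d n ε ^ 2 ≤ η) :
    gaussianMatrixLaw d n {a | ∃ xhat, IsSolution U m (Matrix.of a) (measure (Matrix.of a) xo) ε
      xhat ∧ η < ‖xo - xhat‖ ^ 2} ≤ ENNReal.ofReal (3 * (1 / 2) ^ d) := by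
  set r := representative U m n
  have hsub : {a : Fin d → Fin n → ℝ | ∃ xhat, IsSolution U m (Matrix.of a)
        (measure (Matrix.of a) xo) ε xhat ∧ η < ‖xo - xhat‖ ^ 2}
      ⊆ {a | 512 * (1 + n / d) < sigmaMax (Matrix.of a) ^ 2} ∪ ⋃ p ∈ programs (4 * d),
        {a | ‖measure (Matrix.of a) (r p - xo)‖ ^ 2 < ‖r p - xo‖ ^ 2 / 10000} := by
    rintro a ⟨xhat, hsol, hlt⟩
    by_contra hbad
    simp only [Set.mem_union, Set.mem_iUnion, Set.mem_ofPred_eq, not_or, not_exists,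
      not_lt] at hbad
    have h := norm_sub_le_errorBound hU hn hm hxt hε hL hbad.1 hbad.2 hsol
    exact absurd ((pow_le_pow_left₀ (norm_nonneg _) h 2).trans hη) (not_le.2 hlt)
  calc _ ≤ ENNReal.ofReal ((1 / 2) ^ d)
        + ∑ p ∈ programs (4 * d), ENNReal.ofReal ((1 / 32) ^ d) :=
      (measure_mono hsub).trans <| (measure_union_le _ _).trans <|
        add_le_add (gaussianMatrixLaw_lt_sq_sigmaMax hd) <|
          (measure_biUnion_finset_le _ _).trans <|
            Finset.sum_le_sum fun p _ => gaussianMatrixLaw_sq_norm_lt _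
    _ = ENNReal.ofReal ((1 / 2) ^ d + (programs (4 * d)).card * (1 / 32) ^ d) := by
      rw [Finset.sum_const, nsmul_eq_mul, ENNReal.ofReal_add (by positivity) (by positivity),
        ENNReal.ofReal_mul (by positivity), ENNReal.ofReal_natCast]
    _ ≤ _ := by
      refine ENNReal.ofReal_le_ofReal ?_
      have hc : ((programs (4 * d)).card : ℝ) ≤ 2 ^ (4 * d + 1) := by
        exact_mod_cast card_programs_le (4 * d)
      -- The rate `1 / 32` beats the `16 ^ d` growth of the number of programs.
      have h1 : (2 : ℝ) ^ (4 * d + 1) * (1 / 32) ^ d = 2 * (1 / 2) ^ d := by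
        rw [pow_succ, pow_mul, mul_right_comm, ← mul_pow]
        norm_num [mul_comm]
      have h2 : ((programs (4 * d)).card : ℝ) * (1 / 32) ^ d ≤ 2 ^ (4 * d + 1) * (1 / 32) ^ d := by
        gcongr
      linarith

/-- One factor 2 is `1 + δ` with `δ = 1`, the other comes from `resolution n ≤ 2 log₂ n`. Positivity
of `κ n` follows from that of the ceiling. -/
theorem quantComplexity_le_four_mul_numMeas {U : List Bool →. List Bool} {κ : ℕ → ℝ} {n : ℕ}
    (hn : 2 ≤ n) (hd : 0 < numMeas κ n) {x : EuclideanSpace ℝ (Fin n)}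
    (h : (quantComplexity U (resolution n) x : ℝ) ≤ (1 + 1) * (κ n * (resolution n : ℝ))) :
    quantComplexity U (resolution n) x ≤ 4 * numMeas κ n := by
  have hlog : 0 < Real.logb 2 n := Real.logb_pos (by norm_num) (by exact_mod_cast hn)
  have hκlog : 0 < κ n * Real.logb 2 n := Nat.ceil_pos.1 hd
  have hκ : 0 < κ n := pos_of_mul_pos_left hκlog hlog.le
  have h1 : κ n * resolution n ≤ κ n * (2 * Real.logb 2 n) :=
    mul_le_mul_of_nonneg_left (resolution_le hn) hκ.le
  have h2 : κ n * Real.logb 2 n ≤ numMeas κ n := Nat.le_ceil _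
  have h3 : (quantComplexity U (resolution n) x : ℝ) ≤ ((4 * numMeas κ n : ℕ) : ℝ) := by
    push_cast
    linarith
  exact_mod_cast h3

end MCP

theorem theorem2 (U : List Bool →. List Bool) (hU : MCP.IsUniversalComputer U)
    (κ ε : ℕ → ℝ)
    (xo xt : ∀ n : ℕ, EuclideanSpace ℝ (Fin n))
    (hxt : ∀ n, xt n ∈ MCP.cube n)
    (hclose : ∀ n, ‖xo n - xt n‖ ≤ ε n)
    (hcomplexity : ∀ δ : ℝ, 0 < δ → ∀ᶠ n in atTop,
      (MCP.quantComplexity U (MCP.resolution n) (xt n) : ℝ)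
        ≤ (1 + δ) * (κ n * (MCP.resolution n : ℝ)))
    (hd : Tendsto (MCP.numMeas κ) atTop atTop)
    (hε : Tendsto ε atTop (𝓝 0))
    (hεd : ε =o[atTop] fun n => (MCP.numMeas κ n : ℝ) / (n : ℝ))
    (Ω : ℕ → Type*) [∀ n, MeasurableSpace (Ω n)] (P : ∀ n, Measure (Ω n))
    [∀ n, IsProbabilityMeasure (P n)]
    (A : ∀ n, Ω n → Matrix (Fin (MCP.numMeas κ n)) (Fin n) ℝ)
    (hA : ∀ n, MCP.IsGaussianMatrix (P n) (A n)) :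
    (∀ n ω, ∃ xhat, MCP.IsSolution U (MCP.resolution n) (A n ω)
      (MCP.measure (A n ω) (xo n)) (ε n) xhat) ∧
    ∀ η : ℝ, 0 < η →
      Tendsto (fun n => P n {ω | ∃ xhat, MCP.IsSolution U (MCP.resolution n) (A n ω)
          (MCP.measure (A n ω) (xo n)) (ε n) xhat ∧ η < ‖xo n - xhat‖ ^ 2})
        atTop (𝓝 0) := by
  refine ⟨fun n ω => MCP.exists_isSolution U _
    (MCP.isFeasible_of_norm_sub_le (A n ω) (hxt n) (hclose n)), fun η hη => ?_⟩
  have hbound : Tendsto (fun n => ENNReal.ofReal (3 * (1 / 2) ^ MCP.numMeas κ n))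
      atTop (𝓝 0) := by
    have h1 := ((tendsto_pow_atTop_nhds_zero_of_lt_one (r := (1 / 2 : ℝ)) (by norm_num)
      (by norm_num)).comp hd).const_mul 3
    have h2 := (ENNReal.continuous_ofReal.tendsto _).comp h1
    simpa [Function.comp_def] using h2
  have herr : ∀ᶠ n in atTop, MCP.errorBound (MCP.numMeas κ n) n (ε n) ^ 2 ≤ η := by
    have h1 := (MCP.tendsto_errorBound hd hε hεd).pow 2
    rw [zero_pow two_ne_zero] at h1
    exact h1.eventually_le_const hη
  refine tendsto_of_tendsto_of_tendsto_of_le_of_le' tendsto_const_nhds hbound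
    (Eventually.of_forall fun _ => zero_le) ?_
  filter_upwards [herr, hcomplexity 1 one_pos, hd.eventually_gt_atTop 0,
    eventually_ge_atTop 2] with n hn hK hdn hn2
  have hlaw := (hA n).hasLaw
  -- This inequality holds for every set, so the event need not be measurable.
  refine (Measure.le_map_apply hlaw.aemeasurable {a | ∃ xhat, MCP.IsSolution U
    (MCP.resolution n) (Matrix.of a) (MCP.measure (Matrix.of a) (xo n)) (ε n) xhat
      ∧ η < ‖xo n - xhat‖ ^ 2}).trans ?_
  rw [hlaw.map_eq]
  exact MCP.gaussianMatrixLaw_exists_isSolution_le hU hdn (by omega)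
    (MCP.le_two_pow_resolution n) (hxt n) (hclose n)
    (MCP.quantComplexity_le_four_mul_numMeas hn2 hdn hK) hn
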